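/- Call a vector positive if all its coordinates are $\ge 0$ and at least one is $> 0$, and strictly positive if all its coordinates are $> 0$. For integers $N\ge 1$, $d\ge 0$ put $$p(N,d)=\frac{1}{2^{N-1}}\sum_{j=0}^{d-1}\binom{N-1}{j}.$$ Let $m,n\ge 1$ and let $A$ be a random real $m\times n$ matrix whose entries are independent (not necessarily identically distributed) random variables, each having a probability density that is an even function. Then the probability that there is a positive $x\in\mathbf{R}^n$ such that $Ax$ is strictly positive is $p(n+m,n)$, and the probability that there is a positive $x\in\mathbf{R}^n$ such that $Ax$ is positive is also $p(n+m,n)$. Here $p(n+m,n)$ is the probability that the origin is not in the convex hull of $n+m$ random points of $\mathbf{R}^n$, for any independent (not necessarily identically distributed) random points $z_1,\dots,z_{n+m}$ of $\mathbf{R}^n$ having probability densities that are symmetric with respect to the origin ($f(-z)=f(z)$). -/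

import Mathlib

open MeasureTheory ProbabilityTheory

noncomputable section

/-- A *positive* vector: all coordinates are nonnegative and at least one of them is positive. -/
def IsPositiveVec {k : ℕ} (x : Fin k → ℝ) : Prop :=
  (∀ i, 0 ≤ x i) ∧ ∃ i, 0 < x i

/-- A *strictly positive* vector: all coordinates are positive. -/
def IsStrictlyPositiveVec {k : ℕ} (x : Fin k → ℝ) : Prop :=
  ∀ i, 0 < x i

/-- The law of `X` under `μ` has a density with respect to Lebesgue measure that is an even
function, `f (-x) = f x`. (Meant for measurable `X`; measurability is required separately.) -/
def HasEvenDensity {Ω E : Type*} [MeasurableSpace Ω] [MeasureSpace E] [Neg E]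
    (X : Ω → E) (μ : Measure Ω) : Prop :=
  ∃ f : E → ENNReal, Measurable f ∧ (∀ x, f (-x) = f x) ∧ μ.map X = volume.withDensity f

/-- `p(N, d) = 2^{-(N-1)} ∑_{j=0}^{d-1} (N-1 choose j)`, for `N ≥ 1`. -/
def wendelP (N d : ℕ) : ℝ :=
  (∑ j ∈ Finset.range d, ((N - 1).choose j : ℝ)) / 2 ^ (N - 1)

end

/-!
Let `f i` be finitely many linear functionals on a real space of dimension `d`. The sign vectors that
they realise correspond to the chambers of a central hyperplane arrangement. In general position
their number depends only on `d` and on the number `N` of functionals: a new hyperplane splits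
exactly the chambers that it meets (`ncard_signPatterns_succ`), and the resulting Pascal recursion
gives `2 * ∑ j < d, (N - 1).choose j` (`ncard_signPatterns`). If the functionals are random and all
`2 ^ N` sign vectors are realised with the same probability, that probability is therefore
`wendelP N d` (`measureReal_exists_forall_pos`).

This applies twice. For independent points with even densities, the functionals are the inner
products with the points, and the positive sign vector is realised exactly if the origin is outside
the convex hull. For a random matrix `A`, the functionals are the `n` coordinates, which are not
random, and the `m` rows of `A`; flipping the signs of coordinates and of rows has the same effect as
flipping the signs of the entries of `A` (`mem_signPatterns_inputOutputFunctionals_iff`), which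
does not change their joint law (`measure_units_smul_mem`).

General position holds almost surely because it says that finitely many determinants do not vanish,
each being of degree at most one in every independent variable and not identically zero
(`ae_pi_of_forall_update`). In general position a nonzero solution of the weak inequalities can be
moved to a solution of the strict ones (`InGeneralPosition.exists_forall_pos`), so up to a null set
it makes no difference which of the two positivity conditions is put on the input and the output.
-/

/-! ### Sign patterns of linear functionals in general position -/

section SignPatterns

variable {ι V : Type*} [AddCommGroup V] [Module ℝ V]

/-- The sign vectors realised by a family of linear functionals: `s` is realised if some point `y`
has `f i y` of sign `s i` for every `i`. These sign vectors correspond to the open chambers of the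
arrangement of the hyperplanes `f i = 0`. -/
def signPatterns (f : ι → Module.Dual ℝ V) : Set (ι → ℤˣ) :=
  {s | ∃ y, ∀ i, 0 < ((s i : ℤ) : ℝ) * f i y}

/-- A family of linear functionals is in general position if all its subfamilies that are no larger
than the dimension are linearly independent. -/
def InGeneralPosition (f : ι → Module.Dual ℝ V) : Prop :=
  ∀ S : Finset ι, S.card ≤ Module.finrank ℝ V → LinearIndepOn ℝ f (S : Set ι)

/-- A point where finitely many quantities are nonnegative can be moved slightly in a direction in
which the vanishing ones increase, so that all of them become positive. -/
lemma exists_pos_forall_add_mul_pos [Finite ι] (a b : ι → ℝ)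
    (h : ∀ i, 0 < a i ∨ (a i = 0 ∧ 0 < b i)) : ∃ ε > 0, ∀ i, 0 < a i + ε * b i := by
  have key : ∀ᶠ ε in nhdsWithin (0 : ℝ) (Set.Ioi 0), ∀ i, 0 < a i + ε * b i := by
    rw [Filter.eventually_all]
    intro i
    rcases h i with hi | ⟨hi, hb⟩
    · have hc : Filter.Tendsto (fun ε : ℝ => a i + ε * b i) (nhdsWithin 0 (Set.Ioi 0))
          (nhds (a i + 0 * b i)) :=
        (Continuous.tendsto (by fun_prop) 0).mono_left nhdsWithin_le_nhds
      rw [zero_mul, add_zero] at hc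
      exact hc.eventually (lt_mem_nhds hi)
    · filter_upwards [self_mem_nhdsWithin] with ε hε
      rw [hi, zero_add]
      exact mul_pos hε hb
  obtain ⟨ε, h1, h2⟩ := (key.and self_mem_nhdsWithin).exists
  exact ⟨ε, h2, h1⟩

/-- A linearly independent family of functionals takes arbitrary prescribed values at some
point. -/
lemma exists_forall_apply_eq_of_linearIndepOn [FiniteDimensional ℝ V] {f : ι → Module.Dual ℝ V}
    {S : Set ι} (h : LinearIndepOn ℝ f S) (c : ι → ℝ) : ∃ y, ∀ i ∈ S, f i y = c i := by
  obtain ⟨φ, hφ⟩ := LinearMap.exists_extend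
    ((Module.Basis.span h.linearIndependent).constr ℝ (fun i : S => c i))
  refine ⟨(Module.evalEquiv ℝ V).symm φ, fun i hi => ?_⟩
  rw [Module.apply_evalEquiv_symm_apply]
  have h1 := (Module.Basis.span h.linearIndependent).constr_basis ℝ (fun i : S => c i) ⟨i, hi⟩
  rw [← hφ] at h1
  rw [← h1, LinearMap.comp_apply, Submodule.subtype_apply, Module.Basis.span_apply]

/-- In general position, a nonzero solution of the weak inequalities `0 ≤ f i y` yields a solution
of the strict ones: fewer than `dim V` of the functionals vanish at `y`, so these are independent,
and `y` can be moved in a direction where they are all equal to `1`. -/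
lemma InGeneralPosition.exists_forall_pos [Finite ι] [FiniteDimensional ℝ V]
    {f : ι → Module.Dual ℝ V} (hf : InGeneralPosition f) {y : V} (hy : y ≠ 0)
    (h : ∀ i, 0 ≤ f i y) : ∃ y, ∀ i, 0 < f i y := by
  classical
  have := Fintype.ofFinite ι
  set Z : Finset ι := Finset.univ.filter fun i => f i y = 0 with hZ
  have hcard : Z.card ≤ Module.finrank ℝ V := by
    by_contra! hlt
    obtain ⟨T, hTZ, hT⟩ := Finset.exists_subset_card_eq hlt.le
    have hspan := (hf T hT.le).linearIndependent.span_eq_top_of_card_eq_finrank'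
      (by simpa [Subspace.dual_finrank_eq] using hT)
    -- `T` spans the dual space, so every functional vanishes at `y`
    refine hy ((Module.forall_dual_apply_eq_zero_iff ℝ y).1 fun φ => ?_)
    have hle : Submodule.span ℝ (Set.range fun i : (T : Set ι) => f i) ≤
        LinearMap.ker (Module.Dual.eval ℝ V y) := by
      rw [Submodule.span_le]
      rintro _ ⟨i, rfl⟩
      exact (Finset.mem_filter.1 (hTZ i.2)).2
    exact hle (hspan ▸ Submodule.mem_top)
  obtain ⟨w, hw⟩ := exists_forall_apply_eq_of_linearIndepOn (hf Z hcard) fun _ => 1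
  obtain ⟨ε, -, hε⟩ := exists_pos_forall_add_mul_pos (fun i => f i y) (fun i => f i w) fun i => by
    rcases (h i).lt_or_eq with hi | hi
    · exact Or.inl hi
    · refine Or.inr ⟨hi.symm, ?_⟩
      rw [hw i (by simp [hZ, hi.symm])]
      exact one_pos
  exact ⟨y + ε • w, fun i => by simpa using hε i⟩

/-- A functional can be added to a realised system of strict inequalities with the prescribed sign
`c` as soon as the system has a solution at which that functional vanishes. -/
lemma exists_forall_pos_and_mul_pos [Finite ι] {f : ι → Module.Dual ℝ V} {g : Module.Dual ℝ V}
    (hg : g ≠ 0) {c : ℝ} (hc : c ≠ 0) {s : ι → ℝ} {y : V} (hy : ∀ i, 0 < s i * f i y)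
    (hgy : g y = 0) : ∃ z, 0 < c * g z ∧ ∀ i, 0 < s i * f i z := by
  obtain ⟨w, hw⟩ : ∃ w, g w ≠ 0 := by
    by_contra! hall
    exact hg (LinearMap.ext hall)
  obtain ⟨ε, hε, h⟩ := exists_pos_forall_add_mul_pos (fun i => s i * f i y)
    (fun i => s i * f i ((c * g w) • w)) fun i => Or.inl (hy i)
  refine ⟨y + ε • ((c * g w) • w), ?_, fun i => ?_⟩
  · have : c * g (y + ε • ((c * g w) • w)) = ε * (c * g w) ^ 2 := by
      simp only [map_add, map_smul, hgy, smul_eq_mul]; ring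
    rw [this]
    positivity
  · have := h i
    simp only [map_add, map_smul, smul_eq_mul] at this ⊢
    linarith

/-- Deletion and restriction: adding a hyperplane to an arrangement splits exactly the chambers that
it meets, and these correspond to the chambers of the arrangement induced on the hyperplane. -/
lemma ncard_signPatterns_succ {N : ℕ} (f : Fin (N + 1) → Module.Dual ℝ V) (h0 : f 0 ≠ 0) :
    (signPatterns f).ncard = (signPatterns fun i : Fin N => f i.succ).ncard +
      (signPatterns fun i : Fin N => (f i.succ).domRestrict (LinearMap.ker (f 0))).ncard := by
  set C : ℤˣ → (Fin N → ℤˣ) → Fin (N + 1) → ℤˣ := fun u s => Fin.cons u s with hC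
  set A : ℤˣ → Set (Fin N → ℤˣ) := fun u => {s | Fin.cons u s ∈ signPatterns f} with hA
  have mem_A : ∀ u s, s ∈ A u ↔
      ∃ y, 0 < ((u : ℤ) : ℝ) * f 0 y ∧ ∀ i : Fin N, 0 < ((s i : ℤ) : ℝ) * f i.succ y := by
    intro u s
    simp [hA, signPatterns, Fin.forall_fin_succ]
  have hsplit : signPatterns f = (C 1 '' A 1) ∪ (C (-1) '' A (-1)) := by
    ext s
    constructor
    · intro hs
      rw [← Fin.cons_self_tail s] at hs ⊢
      rcases Int.units_eq_one_or (s 0) with h | h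
      · rw [h] at hs ⊢; exact Or.inl ⟨_, hs, rfl⟩
      · rw [h] at hs ⊢; exact Or.inr ⟨_, hs, rfl⟩
    · rintro (⟨t, ht, rfl⟩ | ⟨t, ht, rfl⟩) <;> exact ht
  have hdisj : Disjoint (C 1 '' A 1) (C (-1) '' A (-1)) := by
    rw [Set.disjoint_left]
    rintro _ ⟨s, -, rfl⟩ ⟨t, -, h⟩
    have := congrFun h 0
    simp [hC] at this
  have hunion : A 1 ∪ A (-1) = signPatterns fun i : Fin N => f i.succ := by
    ext s
    constructor
    · rintro (h | h) <;> obtain ⟨y, -, hy⟩ := (mem_A _ _).1 h <;> exact ⟨y, hy⟩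
    · rintro ⟨y, hy⟩
      rcases lt_trichotomy (f 0 y) 0 with h | h | h
      · exact Or.inr ((mem_A _ _).2 ⟨y, by simpa using h, hy⟩)
      · refine Or.inl ((mem_A _ _).2 ?_)
        exact exists_forall_pos_and_mul_pos h0 (by simp) hy h
      · exact Or.inl ((mem_A _ _).2 ⟨y, by simpa using h, hy⟩)
  have hinter : A 1 ∩ A (-1) =
      signPatterns fun i : Fin N => (f i.succ).domRestrict (LinearMap.ker (f 0)) := by
    ext s
    constructor
    · rintro ⟨h, h'⟩
      obtain ⟨y, hy0, hy⟩ := (mem_A _ _).1 h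
      obtain ⟨z, hz0, hz⟩ := (mem_A _ _).1 h'
      simp only [Units.val_one, Int.cast_one, one_mul, Units.val_neg, Int.cast_neg, neg_mul,
        Left.neg_pos_iff] at hy0 hz0
      -- the segment from `y` to `z` stays in the open cone of `s` and crosses the hyperplane here
      refine ⟨⟨(-f 0 z) • y + f 0 y • z, ?_⟩, fun i => ?_⟩
      · simp only [LinearMap.mem_ker, map_add, map_smul, smul_eq_mul]; ring
      · have h1 := mul_pos (neg_pos.2 hz0) (hy i)
        have h2 := mul_pos hy0 (hz i)
        simp only [LinearMap.domRestrict_apply, map_add, map_smul, smul_eq_mul]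
        nlinarith
    · rintro ⟨⟨y, hy0⟩, hy⟩
      exact ⟨(mem_A _ _).2 (exists_forall_pos_and_mul_pos h0 (by simp) hy hy0),
        (mem_A _ _).2 (exists_forall_pos_and_mul_pos h0 (by simp) hy hy0)⟩
  have hC_inj : ∀ u, (C u).Injective := fun u => Fin.cons_right_injective (α := fun _ => ℤˣ) u
  rw [hsplit, Set.ncard_union_eq hdisj, Set.ncard_image_of_injective _ (hC_inj _),
    Set.ncard_image_of_injective _ (hC_inj _), ← hunion, ← hinter,
    Set.ncard_union_add_ncard_inter]

lemma InGeneralPosition.comp_injective {κ : Type*} {f : ι → Module.Dual ℝ V}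
    (hf : InGeneralPosition f) {g : κ → ι} (hg : g.Injective) : InGeneralPosition (f ∘ g) := by
  intro S hS
  have h := hf (S.map ⟨g, hg⟩) (by simpa using hS)
  rw [Finset.coe_map] at h
  exact h.comp_of_image hg.injOn

lemma InGeneralPosition.restrict_ker [FiniteDimensional ℝ V] {N : ℕ}
    {f : Fin (N + 1) → Module.Dual ℝ V} (hf : InGeneralPosition f) (h0 : f 0 ≠ 0) :
    InGeneralPosition fun i : Fin N => (f i.succ).domRestrict (LinearMap.ker (f 0)) := by
  classical
  intro S hS
  have hrank := Module.Dual.finrank_ker_add_one_of_ne_zero h0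
  rw [linearIndepOn_finset_iff]
  intro c hc
  -- a relation on the kernel of `f 0` is a relation modulo `f 0`
  obtain ⟨a, ha⟩ : ∃ a : ℝ, a • f 0 = ∑ i ∈ S, c i • f i.succ := by
    rw [← Submodule.mem_span_singleton, ← Set.range_const (ι := Unit)]
    refine mem_span_of_iInf_ker_le_ker fun y hy => ?_
    have hy0 : y ∈ LinearMap.ker (f 0) := by simpa using hy
    have := LinearMap.congr_fun hc ⟨y, hy0⟩
    simpa using this
  have hind := hf (Finset.cons 0 (S.map (Fin.succEmb N)) (by simp [Fin.succ_ne_zero]))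
    (by rw [Finset.card_cons, Finset.card_map]; lia)
  rw [linearIndepOn_finset_iff] at hind
  have hzero := hind (Fin.cons (-a) c) (by
    rw [Finset.sum_cons, Finset.sum_map]
    simp [← ha])
  intro i hi
  simpa using hzero i.succ (by simp [hi])

lemma signPatterns_eq_empty [Nonempty ι] [FiniteDimensional ℝ V] (f : ι → Module.Dual ℝ V)
    (h : Module.finrank ℝ V = 0) : signPatterns f = ∅ := by
  have := Module.finrank_zero_iff.1 h
  rw [Set.eq_empty_iff_forall_notMem]
  rintro s ⟨y, hy⟩
  have hi := hy (Classical.arbitrary ι)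
  rw [Subsingleton.elim y 0, map_zero, mul_zero] at hi
  exact lt_irrefl _ hi

lemma InGeneralPosition.ne_zero {f : ι → Module.Dual ℝ V} (hf : InGeneralPosition f)
    (h : Module.finrank ℝ V ≠ 0) (i : ι) : f i ≠ 0 :=
  (hf {i} (by simpa using Nat.one_le_iff_ne_zero.2 h)).ne_zero (by simp)

/-- The number of chambers of a central arrangement of `N + 1` hyperplanes in general position. -/
lemma ncard_signPatterns_fin (N : ℕ) : ∀ {V : Type*} [AddCommGroup V] [Module ℝ V]
    [FiniteDimensional ℝ V] (f : Fin (N + 1) → Module.Dual ℝ V), InGeneralPosition f →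
    (signPatterns f).ncard = 2 * ∑ j ∈ Finset.range (Module.finrank ℝ V), N.choose j := by
  induction N with
  | zero =>
    intro V _ _ _ f hf
    rcases eq_or_ne (Module.finrank ℝ V) 0 with h | h
    · simp [signPatterns_eq_empty f h, h]
    · have huniv : ∀ {W : Type _} [AddCommGroup W] [Module ℝ W] (g : Fin 0 → Module.Dual ℝ W),
          (signPatterns g).ncard = 1 := by
        intro W _ _ g
        rw [Set.ncard_eq_one]
        exact ⟨Fin.elim0, Set.eq_singleton_iff_unique_mem.2
          ⟨⟨0, fun i => i.elim0⟩, fun s _ => Subsingleton.elim _ _⟩⟩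
      obtain ⟨d, hd⟩ := Nat.exists_eq_succ_of_ne_zero h
      rw [ncard_signPatterns_succ f (hf.ne_zero h 0), huniv, huniv, hd, Nat.succ_eq_add_one,
        Finset.sum_range_succ']
      simp
  | succ N ih =>
    intro V _ _ _ f hf
    rcases eq_or_ne (Module.finrank ℝ V) 0 with h | h
    · simp [signPatterns_eq_empty f h, h]
    · have h0 := hf.ne_zero h 0
      obtain ⟨d, hd⟩ := Nat.exists_eq_succ_of_ne_zero h
      have hker : Module.finrank ℝ (LinearMap.ker (f 0)) = d := by
        have := Module.Dual.finrank_ker_add_one_of_ne_zero h0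
        lia
      rw [ncard_signPatterns_succ f h0,
        ih (fun i => f i.succ) (hf.comp_injective (Fin.succ_injective _)),
        ih _ (hf.restrict_ker h0), hker, hd, Nat.succ_eq_add_one]
      simp only [Finset.sum_range_succ', Nat.choose_succ_succ, Nat.choose_zero_right,
        Finset.sum_add_distrib]
      ring

theorem ncard_signPatterns [Fintype ι] [Nonempty ι] [FiniteDimensional ℝ V]
    {f : ι → Module.Dual ℝ V} (hf : InGeneralPosition f) :
    (signPatterns f).ncard =
      2 * ∑ j ∈ Finset.range (Module.finrank ℝ V), (Fintype.card ι - 1).choose j := by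
  obtain ⟨N, hN⟩ := Nat.exists_eq_succ_of_ne_zero (Fintype.card_ne_zero (α := ι))
  set e : Fin (N + 1) ≃ ι := (Fintype.equivFinOfCardEq hN).symm
  have himage : signPatterns f = (e.arrowCongr (Equiv.refl ℤˣ)) '' signPatterns (f ∘ e) := by
    rw [Equiv.image_eq_preimage_symm]
    ext s
    exact exists_congr fun y => e.forall_congr_right.symm
  rw [himage, Set.ncard_image_of_injective _ (Equiv.injective _),
    ncard_signPatterns_fin N _ (hf.comp_injective e.injective), hN, Nat.succ_sub_one]

end SignPatterns

/-! ### Averaging over sign changes -/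

section Averaging

variable {Ω ι V : Type*} [MeasurableSpace Ω] [Fintype ι]
  [NormedAddCommGroup V] [NormedSpace ℝ V] [FiniteDimensional ℝ V]

/-- The solution set of strict linear inequalities is open, so solvability can be tested on a
countable dense set. -/
lemma measurableSet_exists_forall_pos {F : Ω → ι → Module.Dual ℝ V}
    (hF : ∀ i y, Measurable fun ω => F ω i y) :
    MeasurableSet {ω | ∃ y, ∀ i, 0 < F ω i y} := by
  have hdense : {ω | ∃ y, ∀ i, 0 < F ω i y} =
      ⋃ k, ⋂ i, {ω | 0 < F ω i (TopologicalSpace.denseSeq V k)} := by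
    ext ω
    simp only [Set.mem_ofPred_eq, Set.mem_iUnion, Set.mem_iInter]
    constructor
    · intro h
      have hopen : IsOpen {y | ∀ i, 0 < F ω i y} := by
        rw [Set.ofPred_forall]
        exact isOpen_iInter_of_finite fun i =>
          isOpen_lt continuous_const (F ω i).continuous_of_finiteDimensional
      exact (TopologicalSpace.denseRange_denseSeq V).exists_mem_open hopen h
    · rintro ⟨k, hk⟩
      exact ⟨_, hk⟩
  rw [hdense]
  exact MeasurableSet.iUnion fun k => MeasurableSet.iInter fun i =>
    measurableSet_lt measurable_const (hF i _)

/-- Wendel's theorem for random functionals: in general position the number of realised sign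
vectors is deterministic, so if all sign vectors are realised with equal probability, this
probability is that number divided by the number of sign vectors. -/
theorem measureReal_exists_forall_pos [Nonempty ι] (μ : Measure Ω) [IsProbabilityMeasure μ]
    {F : Ω → ι → Module.Dual ℝ V} (hF : ∀ i y, Measurable fun ω => F ω i y)
    (hpos : ∀ᵐ ω ∂μ, InGeneralPosition (F ω))
    (hsymm : ∀ s : ι → ℤˣ, μ {ω | s ∈ signPatterns (F ω)} = μ {ω | ∃ y, ∀ i, 0 < F ω i y}) :
    μ.real {ω | ∃ y, ∀ i, 0 < F ω i y} = wendelP (Fintype.card ι) (Module.finrank ℝ V) := by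
  classical
  have hmeas : ∀ s : ι → ℤˣ, MeasurableSet {ω | s ∈ signPatterns (F ω)} := fun s =>
    measurableSet_exists_forall_pos (F := fun ω i => ((s i : ℤ) : ℝ) • F ω i)
      fun i y => (hF i y).const_mul _
  have hsum : ∑ s : ι → ℤˣ, μ.real {ω | s ∈ signPatterns (F ω)} =
      ((2 * ∑ j ∈ Finset.range (Module.finrank ℝ V), (Fintype.card ι - 1).choose j : ℕ) : ℝ) := by
    have hint : ∀ s : ι → ℤˣ, μ.real {ω | s ∈ signPatterns (F ω)} =
        ∫ ω, Set.indicator {ω | s ∈ signPatterns (F ω)} (fun _ => 1) ω ∂μ := fun s =>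
      (integral_indicator_one (hmeas s)).symm
    simp_rw [hint]
    rw [← integral_finsetSum _ fun s _ => (integrable_const (1 : ℝ)).indicator (hmeas s)]
    have hae : ∀ᵐ ω ∂μ, (∑ s : ι → ℤˣ, 
        Set.indicator {ω | s ∈ signPatterns (F ω)} (fun _ => 1) ω : ℝ) =
        ((2 * ∑ j ∈ Finset.range (Module.finrank ℝ V), (Fintype.card ι - 1).choose j : ℕ) : ℝ) := by
      filter_upwards [hpos] with ω hω
      simp only [Set.indicator_apply, Set.mem_ofPred_eq]
      rw [Finset.sum_boole, ← ncard_signPatterns hω, ← Set.ncard_coe_finset,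
        Finset.coe_filter_univ, Set.ofPred_mem_eq]
    rw [integral_congr_ae hae]
    simp
  have hcard : Fintype.card (ι → ℤˣ) = 2 ^ Fintype.card ι := by simp
  simp_rw [measureReal_def, hsymm, ← measureReal_def] at hsum
  rw [Finset.sum_const, Finset.card_univ, hcard, nsmul_eq_mul] at hsum
  obtain ⟨N, hN⟩ := Nat.exists_eq_succ_of_ne_zero (Fintype.card_ne_zero (α := ι))
  rw [wendelP, eq_div_iff (by positivity)]
  rw [hN] at hsum ⊢
  push_cast [pow_succ, Nat.succ_sub_one] at hsum ⊢
  linarith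

end Averaging

/-! ### Symmetric laws -/

section Symmetry

variable {Ω ι E : Type*} [MeasurableSpace Ω] {μ : Measure Ω}

lemma HasEvenDensity.map_neg [MeasureSpace E] [AddGroup E] [MeasurableNeg E]
    [(volume : Measure E).IsNegInvariant] {X : Ω → E} (hX : Measurable X)
    (h : HasEvenDensity X μ) : μ.map (fun ω => -X ω) = μ.map X := by
  obtain ⟨f, -, hf, hmap⟩ := h
  have hcomp : μ.map (fun ω => -X ω) = (μ.map X).map Neg.neg :=
    (Measure.map_map measurable_neg hX).symm
  rw [hcomp, hmap]
  ext s hs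
  rw [Measure.map_apply measurable_neg hs, withDensity_apply _ (measurable_neg hs),
    withDensity_apply _ hs]
  have hpre := (Measure.measurePreserving_neg (volume : Measure E)).setLIntegral_comp_preimage_emb
    (MeasurableEquiv.neg E).measurableEmbedding f s
  simpa only [hf] using hpre

lemma HasEvenDensity.absolutelyContinuous [MeasureSpace E] [Neg E] {X : Ω → E}
    (h : HasEvenDensity X μ) : μ.map X ≪ volume := by
  obtain ⟨f, -, -, hmap⟩ := h
  exact hmap ▸ withDensity_absolutelyContinuous _ _

/-- The joint law of independent random variables with symmetric laws is invariant under arbitrary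
changes of signs. -/
lemma measure_units_smul_mem [Fintype ι] [IsProbabilityMeasure μ] [MeasurableSpace E] [AddCommGroup E]
    [MeasurableNeg E] {X : ι → Ω → E} (hX : ∀ i, Measurable (X i)) (hind : iIndepFun X μ)
    (hneg : ∀ i, μ.map (fun ω => -X i ω) = μ.map (X i)) (s : ι → ℤˣ) {S : Set (ι → E)}
    (hS : MeasurableSet S) : μ {ω | (fun i => s i • X i ω) ∈ S} = μ {ω | (fun i => X i ω) ∈ S} := by
  have hmeas : ∀ u : ℤˣ, Measurable fun x : E => u • x := by
    intro u
    rcases Int.units_eq_one_or u with rfl | rfl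
    · simp only [one_smul]
      exact measurable_id
    · simpa [Units.smul_def] using measurable_neg
  have hmap : ∀ i, μ.map (fun ω => s i • X i ω) = μ.map (X i) := by
    intro i
    rcases Int.units_eq_one_or (s i) with h | h
    · simp [h]
    · simpa [h, Units.smul_def] using hneg i
  have hsmul := (hind.comp (fun i x => s i • x) fun i => hmeas (s i)).map_fun_eq_pi_map
    fun i => ((hmeas (s i)).comp (hX i)).aemeasurable
  have hlaw : μ.map (fun ω i => s i • X i ω) = μ.map (fun ω i => X i ω) := by
    rw [hind.map_fun_eq_pi_map fun i => (hX i).aemeasurable]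
    exact hsmul.trans (congrArg _ (funext hmap))
  have heq := congrArg (fun ν : Measure (ι → E) => ν S) hlaw
  have hsX : Measurable fun ω i => s i • X i ω :=
    measurable_pi_lambda _ fun i => (hmeas (s i)).comp (hX i)
  rwa [Measure.map_apply hsX hS,
    Measure.map_apply (measurable_pi_lambda _ hX) hS] at heq

end Symmetry

/-! ### Generic properties under product measures -/

section Generic

variable {Ω ι E : Type*} [MeasurableSpace Ω] [MeasurableSpace E]

lemma ae_pi_of_forall_update_fin (k : ℕ) (ν : Fin k → Measure E) [∀ i, SigmaFinite (ν i)]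
    (p : (Fin k → E) → Prop) (hp : MeasurableSet {x | p x})
    (h : ∀ i x, p x → ∀ᵐ e ∂ν i, p (Function.update x i e)) (hex : ∃ x, p x) :
    ∀ᵐ x ∂Measure.pi ν, p x := by
  induction k with
  | zero =>
    obtain ⟨x, hx⟩ := hex
    exact Filter.Eventually.of_forall fun y => Subsingleton.elim x y ▸ hx
  | succ k ih =>
    obtain ⟨x₀, hx₀⟩ := hex
    have hcons : Measurable fun z : E × (Fin k → E) => (Fin.cons z.1 z.2 : Fin (k + 1) → E) := by
      refine measurable_pi_lambda _ (Fin.cases measurable_fst fun i => ?_)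
      exact (measurable_pi_apply i).comp measurable_snd
    have hprod : ∀ᵐ z ∂(ν 0).prod (Measure.pi fun i : Fin k => ν i.succ),
        p (Fin.cons z.1 z.2) := by
      refine (Measure.ae_prod_iff_ae_ae (p := fun z : E × (Fin k → E) => p (Fin.cons z.1 z.2))
        (hcons hp)).2 ?_
      have h0 := h 0 x₀ hx₀
      filter_upwards [h0] with e he
      refine ih _ (fun x => p (Fin.cons e x)) ((hcons.comp measurable_prodMk_left) hp)
        (fun i x hx => ?_) ⟨Fin.tail x₀, ?_⟩
      · simpa only [Fin.cons_update] using h i.succ _ hx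
      · rwa [← Fin.cons_self_tail x₀, Fin.update_cons_zero] at he
    have hmp := measurePreserving_piFinSuccAbove ν 0
    have := hmp.quasiMeasurePreserving.ae hprod
    filter_upwards [this] with x hx
    simpa [MeasurableEquiv.piFinSuccAbove, Fin.insertNthEquiv] using hx

/-- If a property of families of points survives almost every change of any one of the points, then
it holds almost everywhere for a product measure as soon as it holds somewhere. This is the argument
by which a nonzero polynomial vanishes almost nowhere. -/
lemma ae_pi_of_forall_update [Fintype ι] [DecidableEq ι] (ν : ι → Measure E)
    [∀ i, SigmaFinite (ν i)] (p : (ι → E) → Prop) (hp : MeasurableSet {x | p x})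
    (h : ∀ i x, p x → ∀ᵐ e ∂ν i, p (Function.update x i e)) (hex : ∃ x, p x) :
    ∀ᵐ x ∂Measure.pi ν, p x := by
  set e : Fin (Fintype.card ι) ≃ ι := (Fintype.equivFin ι).symm
  have hcomp : Measurable fun x : Fin (Fintype.card ι) → E => x ∘ e.symm :=
    measurable_pi_lambda _ fun i => measurable_pi_apply _
  have hfin := ae_pi_of_forall_update_fin _ (fun i => ν (e i)) (fun x => p (x ∘ e.symm))
    (hcomp hp) (fun i x hx => by
      simpa only [Function.update_comp_equiv, Equiv.symm_symm] using h (e i) _ hx)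
    (hex.imp' (· ∘ e) fun x hx => by simpa [Function.comp_assoc] using hx)
  have hmp := (measurePreserving_piCongrLeft ν e).symm
  filter_upwards [hmp.quasiMeasurePreserving.ae hfin] with x hx
  convert hx using 1
  ext i
  simp [MeasurableEquiv.piCongrLeft]

/-- The version of `ae_pi_of_forall_update` for independent random variables. -/
lemma ProbabilityTheory.iIndepFun.ae_of_forall_update [Fintype ι] [DecidableEq ι] {μ : Measure Ω}
    [IsProbabilityMeasure μ] {X : ι → Ω → E} (hX : ∀ i, Measurable (X i)) (hind : iIndepFun X μ)
    (p : (ι → E) → Prop) (hp : MeasurableSet {x | p x})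
    (h : ∀ i x, p x → ∀ᵐ e ∂μ.map (X i), p (Function.update x i e)) (hex : ∃ x, p x) :
    ∀ᵐ ω ∂μ, p fun i => X i ω := by
  have := fun i => Measure.isProbabilityMeasure_map (μ := μ) (hX i).aemeasurable
  have hae := ae_pi_of_forall_update (fun i => μ.map (X i)) p hp h hex
  rw [← hind.map_fun_eq_pi_map fun i => (hX i).aemeasurable] at hae
  exact ae_of_ae_map (measurable_pi_lambda _ hX).aemeasurable hae

end Generic

/-! ### General position through determinants -/

lemma inGeneralPosition_of_det_ne_zero {ι V : Type*} [Fintype ι] [AddCommGroup V] [Module ℝ V]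
    {n : ℕ} (b : Module.Basis (Fin n) ℝ V) {f : ι → Module.Dual ℝ V} (hn : n ≤ Fintype.card ι)
    (h : ∀ g : Fin n → ι, g.Injective → (Matrix.of fun j k => f (g j) (b k)).det ≠ 0) :
    InGeneralPosition f := by
  intro S hS
  rw [Module.finrank_eq_card_basis b, Fintype.card_fin] at hS
  obtain ⟨T, hST, hT⟩ := Finset.exists_superset_card_eq hS hn
  refine LinearIndepOn.mono ?_ (Finset.coe_subset.2 hST)
  set e : Fin n ≃ T := (Finset.equivFinOfCardEq hT).symm
  have hrows := Matrix.linearIndependent_rows_of_det_ne_zero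
    (h (fun j => e j) (Subtype.val_injective.comp e.injective))
  refine (linearIndependent_equiv e).1 (LinearIndependent.of_comp
    (LinearMap.pi fun k => Module.Dual.eval ℝ V (b k)) hrows)

/-! ### Random points with even densities -/

section RandomPoints

variable {n : ℕ}

/-- By Gordan's alternative, finitely many points have the origin outside their convex hull exactly
if they lie in an open half-space. -/
lemma zero_notMem_convexHull_range_iff {ι E : Type*} [Finite ι] [NormedAddCommGroup E]
    [InnerProductSpace ℝ E] [CompleteSpace E] (z : ι → E) :
    (0 : E) ∉ convexHull ℝ (Set.range z) ↔ ∃ y, ∀ i, 0 < innerₗ E (z i) y := by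
  constructor
  · intro h
    obtain ⟨φ, u, hu, hφ⟩ := geometric_hahn_banach_point_closed (convex_convexHull ℝ _)
      ((Set.finite_range z).isClosed_convexHull ℝ) h
    refine ⟨(InnerProductSpace.toDual ℝ E).symm φ, fun i => ?_⟩
    rw [innerₗ_apply_apply, real_inner_comm, InnerProductSpace.toDual_symm_apply]
    rw [map_zero] at hu
    exact hu.trans (hφ _ (subset_convexHull ℝ _ ⟨i, rfl⟩))
  · rintro ⟨y, hy⟩ h
    have hsub : convexHull ℝ (Set.range z) ⊆ {x | 0 < (innerₗ E).flip y x} := by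
      refine convexHull_min ?_ (convex_halfSpace_gt ((innerₗ E).flip y).isLinear 0)
      rintro _ ⟨i, rfl⟩
      exact hy i
    simpa using hsub h

/-- Independent random points with absolutely continuous laws are almost surely in general position:
a determinant of some of them is linear in each of them, so changing one point destroys its
nonvanishing only on a hyperplane. -/
lemma ae_inGeneralPosition_innerₗ {Ω ι : Type*} [MeasurableSpace Ω] {μ : Measure Ω}
    [IsProbabilityMeasure μ] [Fintype ι] (hn : n ≤ Fintype.card ι)
    {z : ι → Ω → EuclideanSpace ℝ (Fin n)} (hz : ∀ i, Measurable (z i)) (hind : iIndepFun z μ)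
    (hac : ∀ i, μ.map (z i) ≪ volume) :
    ∀ᵐ ω ∂μ, InGeneralPosition fun i => innerₗ (EuclideanSpace ℝ (Fin n)) (z i ω) := by
  classical
  let D : (Fin n → EuclideanSpace ℝ (Fin n)) → ℝ := fun w =>
    Matrix.detRowAlternating fun j => (w j).ofLp
  have hD : Continuous D :=
    Continuous.matrix_det (A := fun w : Fin n → EuclideanSpace ℝ (Fin n) => fun j => (w j).ofLp)
      (by fun_prop)
  have key : ∀ g : Fin n → ι, g.Injective → ∀ᵐ ω ∂μ, D (fun j => z (g j) ω) ≠ 0 := by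
    intro g hg
    refine hind.ae_of_forall_update hz (fun x => D (x ∘ g) ≠ 0) ?_ ?_ ?_
    · exact (hD.comp (by fun_prop)).measurable (measurableSet_singleton 0).compl
    · intro i x hx
      by_cases hi : ∃ a, g a = i
      · obtain ⟨a, rfl⟩ := hi
        let φ : Module.Dual ℝ (EuclideanSpace ℝ (Fin n)) :=
          (Matrix.detRowAlternating.toMultilinearMap.toLinearMap
            (fun j => (x (g j)).ofLp) a) ∘ₗ (WithLp.linearEquiv 2 ℝ (Fin n → ℝ)).toLinearMap
        have hφ : ∀ e, D (Function.update x (g a) e ∘ g) = φ e := by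
          intro e
          rw [Function.update_comp_eq_of_injective _ hg]
          refine congrArg Matrix.detRowAlternating (funext fun j => ?_)
          rcases eq_or_ne j a with rfl | hj
          · simp
          · simp [hj]
        have hker : LinearMap.ker φ ≠ ⊤ := by
          intro htop
          refine hx ?_
          rw [← Function.update_eq_self (g a) x, hφ]
          exact LinearMap.mem_ker.1 (htop ▸ Submodule.mem_top)
        have hnull := hac (g a) (Measure.addHaar_submodule volume (LinearMap.ker φ) hker)
        filter_upwards [measure_eq_zero_iff_ae_notMem.1 hnull] with e he
        rw [hφ]
        exact he
      · refine Filter.Eventually.of_forall fun e => ?_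
        rwa [Function.update_comp_eq_of_forall_ne _ _ fun a ha => hi ⟨a, ha⟩]
    · refine ⟨Function.extend g (fun j => EuclideanSpace.single j 1) 0, ?_⟩
      rw [Function.extend_comp hg]
      have hone : D (fun j => EuclideanSpace.single j 1) = (1 : Matrix (Fin n) (Fin n) ℝ).det := by
        refine congrArg Matrix.det ?_
        ext j k
        simp [Matrix.one_apply, eq_comm]
      rw [hone, Matrix.det_one]
      exact one_ne_zero
  have hall : ∀ᵐ ω ∂μ, ∀ g : Fin n → ι, g.Injective → D (fun j => z (g j) ω) ≠ 0 :=
    ae_all_iff.2 fun g => by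
      by_cases hg : g.Injective
      · simpa [hg] using key g hg
      · simp [hg]
  filter_upwards [hall] with ω hω
  refine inGeneralPosition_of_det_ne_zero (EuclideanSpace.basisFun (Fin n) ℝ).toBasis hn
    fun g hg => ?_
  convert hω g hg using 1
  refine congrArg Matrix.det ?_
  ext j k
  simp [innerₗ_apply_apply, EuclideanSpace.inner_single_right]

/-- Wendel's theorem. -/
theorem measureReal_zero_notMem_convexHull {Ω ι : Type*} [MeasurableSpace Ω] (μ : Measure Ω)
    [IsProbabilityMeasure μ] [Fintype ι] [Nonempty ι] (hn : n ≤ Fintype.card ι)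
    {z : ι → Ω → EuclideanSpace ℝ (Fin n)} (hz : ∀ i, Measurable (z i)) (hind : iIndepFun z μ)
    (heven : ∀ i, HasEvenDensity (z i) μ) :
    μ.real {ω | (0 : EuclideanSpace ℝ (Fin n)) ∉ convexHull ℝ (Set.range fun i => z i ω)} =
      wendelP (Fintype.card ι) n := by
  simp_rw [zero_notMem_convexHull_range_iff]
  have hmeas : ∀ (i : ι) y, Measurable fun x : ι → EuclideanSpace ℝ (Fin n) =>
      innerₗ (EuclideanSpace ℝ (Fin n)) (x i) y := by
    intro i y
    simp only [innerₗ_apply_apply]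
    fun_prop
  have hzmeas : Measurable fun ω i => z i ω := measurable_pi_lambda _ hz
  have hmain := measureReal_exists_forall_pos μ
    (F := fun ω i => innerₗ (EuclideanSpace ℝ (Fin n)) (z i ω))
    (fun i y => (hmeas i y).comp hzmeas)
    (ae_inGeneralPosition_innerₗ hn hz hind fun i => (heven i).absolutelyContinuous)
    fun s => by
      have heq := measure_units_smul_mem hz hind (fun i => (heven i).map_neg (hz i)) s
        (measurableSet_exists_forall_pos hmeas)
      refine Eq.trans (congrArg μ ?_) heq
      ext ω
      simp [signPatterns, Units.smul_def, ← Int.cast_smul_eq_zsmul ℝ, inner_smul_left]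
  rwa [finrank_euclideanSpace_fin] at hmain

end RandomPoints

/-! ### Random matrices with even entries -/

section RandomMatrices

variable {m n : ℕ}

/-- The functionals whose strict positivity at `y` says that both the input `y` and the output `A y`
are strictly positive: the coordinates, followed by the rows of `A`. -/
def inputOutputFunctionals (A : Matrix (Fin m) (Fin n) ℝ) :
    Fin n ⊕ Fin m → Module.Dual ℝ (Fin n → ℝ) :=
  Sum.elim LinearMap.proj fun i => LinearMap.proj i ∘ₗ A.mulVecLin

lemma measurable_inputOutputFunctionals_apply {Ω : Type*} [MeasurableSpace Ω]
    {A : Ω → Matrix (Fin m) (Fin n) ℝ} (hA : ∀ i j, Measurable fun ω => A ω i j)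
    (k : Fin n ⊕ Fin m) (y : Fin n → ℝ) :
    Measurable fun ω => inputOutputFunctionals (A ω) k y := by
  rcases k with j | i
  · exact measurable_const
  · simp only [inputOutputFunctionals, Sum.elim_inr, LinearMap.comp_apply, LinearMap.proj_apply,
      Matrix.mulVecLin_apply, Matrix.mulVec, dotProduct]
    exact Finset.measurable_fun_sum _ fun j _ => (hA i j).mul_const _

/-- Flipping the signs of the coordinates and of the rows amounts, after a reflection of the input,
to flipping the signs of the entries of the matrix. -/
lemma mem_signPatterns_inputOutputFunctionals_iff (A : Matrix (Fin m) (Fin n) ℝ)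
    (s : Fin n ⊕ Fin m → ℤˣ) :
    s ∈ signPatterns (inputOutputFunctionals A) ↔
      ∃ y, ∀ k, 0 < inputOutputFunctionals
        (Matrix.of fun i j => (s (Sum.inr i) * s (Sum.inl j)) • A i j) k y := by
  have hsq : ∀ k, ((s k : ℤ) : ℝ) * ((s k : ℤ) : ℝ) = 1 := fun k => by
    rcases Int.units_eq_one_or (s k) with h | h <;> simp [h]
  let R : (Fin n → ℝ) → Fin n → ℝ := fun y j => ((s (Sum.inl j) : ℤ) : ℝ) * y j
  have hR : R.Involutive := fun y => funext fun j => by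
    simp only [R, ← mul_assoc, hsq, one_mul]
  have key : ∀ y, (∀ k, 0 < ((s k : ℤ) : ℝ) * inputOutputFunctionals A k y) ↔
      ∀ k, 0 < inputOutputFunctionals
        (Matrix.of fun i j => (s (Sum.inr i) * s (Sum.inl j)) • A i j) k (R y) := by
    intro y
    refine forall_congr' fun k => ?_
    rcases k with j | i
    · rfl
    · simp only [inputOutputFunctionals, Sum.elim_inr, LinearMap.comp_apply, LinearMap.proj_apply,
        Matrix.mulVecLin_apply, Matrix.mulVec, dotProduct, Matrix.of_apply, Finset.mul_sum, R,
        Units.smul_def, Units.val_mul, zsmul_eq_mul, Int.cast_mul]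
      have hterm : ∀ j, ((s (Sum.inr i) : ℤ) : ℝ) * (A i j * y j) =
          ((s (Sum.inr i) : ℤ) : ℝ) * ((s (Sum.inl j) : ℤ) : ℝ) * A i j *
            (((s (Sum.inl j) : ℤ) : ℝ) * y j) := fun j => by
        linear_combination (-((s (Sum.inr i) : ℤ) : ℝ) * A i j * y j) * hsq (Sum.inl j)
      simp_rw [hterm]
  exact (exists_congr key).trans ⟨fun ⟨y, hy⟩ => ⟨_, hy⟩, fun ⟨y, hy⟩ => ⟨R y, by rwa [hR y]⟩⟩

/-- Almost every matrix with independent atomless entries makes the coordinates and the rows a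
family in general position: the determinants in question are nonzero polynomials of degree at most
one in each entry. -/
lemma ae_inGeneralPosition_inputOutputFunctionals {Ω : Type*} [MeasurableSpace Ω] {μ : Measure Ω}
    [IsProbabilityMeasure μ] {A : Ω → Matrix (Fin m) (Fin n) ℝ}
    (hA : ∀ i j, Measurable fun ω => A ω i j)
    (hind : iIndepFun (fun (q : Fin m × Fin n) (ω : Ω) => A ω q.1 q.2) μ)
    (hnull : ∀ i j, NullSingletonClass (μ.map fun ω => A ω i j)) :
    ∀ᵐ ω ∂μ, InGeneralPosition (inputOutputFunctionals (A ω)) := by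
  classical
  let M : (Fin n → Fin n ⊕ Fin m) → (Fin m × Fin n → ℝ) → Matrix (Fin n) (Fin n) ℝ := fun g a =>
    Matrix.of fun k => Sum.elim (fun l => Pi.single l 1) (fun r c => a (r, c)) (g k)
  have hM : ∀ g, Continuous (M g) := by
    intro g
    refine continuous_pi fun k => continuous_pi fun c => ?_
    rcases hgk : g k with l | r
    · simpa [M, hgk] using continuous_const
    · simpa [M, hgk] using continuous_apply (r, c)
  have key : ∀ g : Fin n → Fin n ⊕ Fin m, g.Injective →
      ∀ᵐ ω ∂μ, (M g fun q => A ω q.1 q.2).det ≠ 0 := by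
    intro g hg
    refine hind.ae_of_forall_update (fun q => hA q.1 q.2) (fun a => (M g a).det ≠ 0) ?_ ?_ ?_
    · exact ((hM g).matrix_det).measurable (measurableSet_singleton 0).compl
    · rintro ⟨r, c⟩ a ha
      by_cases hr : ∃ k, g k = Sum.inr r
      · obtain ⟨k, hk⟩ := hr
        set d := ((M g a).updateRow k (Pi.single c 1)).det with hd
        have hupdate : ∀ e, (M g (Function.update a (r, c) e)).det =
            (M g a).det + (e - a (r, c)) * d := by
          intro e
          have hrow : M g (Function.update a (r, c) e) =
              (M g a).updateRow k ((M g a) k + (e - a (r, c)) • Pi.single c 1) := by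
            ext k' c'
            rcases eq_or_ne k' k with rfl | hne
            · rcases eq_or_ne c' c with rfl | hc
              · simp [M, hk]
              · simp [M, hk, hc]
            · rcases hgk : g k' with l | r'
              · simp [M, hgk, hne]
              · have hr' : r' ≠ r := fun h => hne (hg (by rw [hgk, hk, h]))
                simp [M, hgk, hne, hr']
          rw [hrow, Matrix.det_updateRow_add, Matrix.updateRow_eq_self, Matrix.det_updateRow_smul]
        have := hnull r c
        filter_upwards [measure_eq_zero_iff_ae_notMem.1
          (measure_singleton (μ := μ.map fun ω => A ω r c) (a (r, c) - (M g a).det / d))] with e he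
        rw [hupdate]
        intro h
        have hd0 : d ≠ 0 := fun h0 => ha (by simpa [h0] using h)
        refine he (Set.mem_singleton_iff.2 ?_)
        field_simp
        linear_combination h
      · refine Filter.Eventually.of_forall fun e => ?_
        have hsame : M g (Function.update a (r, c) e) = M g a := by
          ext k' c'
          rcases hgk : g k' with l | r'
          · simp [M, hgk]
          · have hr' : r' ≠ r := fun h => hr ⟨k', by rw [hgk, h]⟩
            simp [M, hgk, hr']
        rwa [hsame]
    · -- complete the coordinates selected by `g` to a permutation of all coordinates
      obtain ⟨τ, hτ⟩ := Finset.exists_equiv_extend_of_card_eq (α := Fin n) (t := Finset.univ)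
        (s := Finset.univ.filter fun k => (g k).isLeft) (f := fun k => (g k).elim id fun _ => k)
        (by simp) (Finset.subset_univ _) (by
          intro k hk k' hk' h
          obtain ⟨l, hl⟩ := Sum.isLeft_iff.1 (Finset.mem_filter.1 hk).2
          obtain ⟨l', hl'⟩ := Sum.isLeft_iff.1 (Finset.mem_filter.1 hk').2
          refine hg ?_
          simpa [hl, hl'] using h)
      let σ : Equiv.Perm (Fin n) := τ.trans (Equiv.subtypeUnivEquiv Finset.mem_univ)
      refine ⟨fun q => if ∃ k, g k = Sum.inr q.1 ∧ σ k = q.2 then 1 else 0, ?_⟩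
      have hperm : M g (fun q => if ∃ k, g k = Sum.inr q.1 ∧ σ k = q.2 then 1 else 0) =
          (1 : Matrix (Fin n) (Fin n) ℝ).submatrix σ id := by
        ext k c
        rcases hgk : g k with l | r
        · have hσ : σ k = l := by
            have h := hτ k (by simp [hgk])
            rw [hgk] at h
            exact h
          simp [M, hgk, hσ, Matrix.one_apply, Pi.single_apply, eq_comm]
        · have hiff : (∃ k', g k' = Sum.inr r ∧ σ k' = c) ↔ σ k = c :=
            ⟨fun ⟨k', h, h'⟩ => hg (hgk.trans h.symm) ▸ h', fun h => ⟨k, hgk, h⟩⟩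
          simp [M, hgk, hiff, Matrix.one_apply]
      rw [hperm, Matrix.det_permute, Matrix.det_one, mul_one]
      simp
  have hall : ∀ᵐ ω ∂μ, ∀ g : Fin n → Fin n ⊕ Fin m, g.Injective →
      (M g fun q => A ω q.1 q.2).det ≠ 0 :=
    ae_all_iff.2 fun g => by
      by_cases hg : g.Injective
      · simpa [hg] using key g hg
      · simp [hg]
  filter_upwards [hall] with ω hω
  refine inGeneralPosition_of_det_ne_zero (Pi.basisFun ℝ (Fin n)) (by simp) fun g hg => ?_
  convert hω g hg using 1
  refine congrArg Matrix.det ?_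
  ext k c
  rcases hgk : g k with l | r
  · simp [M, hgk, inputOutputFunctionals, Pi.single_apply, eq_comm]
  · simp [M, hgk, inputOutputFunctionals]

/-- The probability that a random matrix with independent even entries has a strictly positive
output on some strictly positive input. -/
lemma measureReal_exists_inputOutputFunctionals_pos {Ω : Type*} [MeasurableSpace Ω] (μ : Measure Ω)
    [IsProbabilityMeasure μ] (hn : 1 ≤ n) {A : Ω → Matrix (Fin m) (Fin n) ℝ}
    (hA : ∀ i j, Measurable fun ω => A ω i j)
    (hind : iIndepFun (fun (q : Fin m × Fin n) (ω : Ω) => A ω q.1 q.2) μ)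
    (heven : ∀ i j, HasEvenDensity (fun ω => A ω i j) μ) :
    μ.real {ω | ∃ y, ∀ k, 0 < inputOutputFunctionals (A ω) k y} = wendelP (n + m) n := by
  have : Nonempty (Fin n ⊕ Fin m) := ⟨Sum.inl ⟨0, hn⟩⟩
  have hgp := ae_inGeneralPosition_inputOutputFunctionals hA hind fun i j =>
    ⟨fun x => (heven i j).absolutelyContinuous (measure_singleton x)⟩
  have hsymm : ∀ s : Fin n ⊕ Fin m → ℤˣ, μ {ω | s ∈ signPatterns (inputOutputFunctionals (A ω))} =
      μ {ω | ∃ y, ∀ k, 0 < inputOutputFunctionals (A ω) k y} := by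
    intro s
    have heq := measure_units_smul_mem (fun q : Fin m × Fin n => hA q.1 q.2) hind
      (fun q => (heven q.1 q.2).map_neg (hA q.1 q.2))
      (fun q => s (Sum.inr q.1) * s (Sum.inl q.2))
      (measurableSet_exists_forall_pos (measurable_inputOutputFunctionals_apply
        (A := fun a : Fin m × Fin n → ℝ => Matrix.of fun i j => a (i, j))
        fun i j => measurable_pi_apply (i, j)))
    have hflip : {ω | s ∈ signPatterns (inputOutputFunctionals (A ω))} =
        {ω | (fun q : Fin m × Fin n => (s (Sum.inr q.1) * s (Sum.inl q.2)) • A ω q.1 q.2) ∈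
          {a : Fin m × Fin n → ℝ | ∃ y, ∀ k, 0 < inputOutputFunctionals
            (Matrix.of fun i j => a (i, j)) k y}} :=
      Set.ext fun ω => mem_signPatterns_inputOutputFunctionals_iff (A ω) s
    rw [hflip]
    exact heq
  have hmain := measureReal_exists_forall_pos μ (measurable_inputOutputFunctionals_apply hA) hgp hsymm
  simpa using hmain

end RandomMatrices

theorem mainTheorem6 {Ω : Type*} [MeasurableSpace Ω] (μ : Measure Ω) [IsProbabilityMeasure μ]
    (m n : ℕ) (hm : 1 ≤ m) (hn : 1 ≤ n)
    (A : Ω → Matrix (Fin m) (Fin n) ℝ)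
    (hA_meas : ∀ i j, Measurable fun ω => A ω i j)
    (hA_indep : iIndepFun (fun (q : Fin m × Fin n) (ω : Ω) => A ω q.1 q.2) μ)
    (hA_even : ∀ i j, HasEvenDensity (fun ω => A ω i j) μ) :
    -- some positive input has a strictly positive output
    μ.real {ω | ∃ x : Fin n → ℝ, IsPositiveVec x ∧ IsStrictlyPositiveVec ((A ω).mulVec x)}
        = wendelP (n + m) n ∧
    -- some positive input has a positive output
    μ.real {ω | ∃ x : Fin n → ℝ, IsPositiveVec x ∧ IsPositiveVec ((A ω).mulVec x)}
        = wendelP (n + m) n ∧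
    -- `p(n + m, n)` is the probability that the convex hull of `n + m` independent random points
    -- of `ℝⁿ` with even densities misses the origin
    (∀ {Ω' : Type*} [MeasurableSpace Ω'] (ν : Measure Ω') [IsProbabilityMeasure ν]
        (z : Fin (n + m) → Ω' → EuclideanSpace ℝ (Fin n)),
        (∀ i, Measurable (z i)) → iIndepFun z ν → (∀ i, HasEvenDensity (z i) ν) →
        ν.real {ω | (0 : EuclideanSpace ℝ (Fin n)) ∉
            convexHull ℝ (Set.range fun i => z i ω)} = wendelP (n + m) n) := by
  have hpos := measureReal_exists_inputOutputFunctionals_pos μ hn hA_meas hA_indep hA_even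
  have hgp := ae_inGeneralPosition_inputOutputFunctionals hA_meas hA_indep fun i j =>
    ⟨fun x => (hA_even i j).absolutelyContinuous (measure_singleton x)⟩
  have strict_imp : ∀ ω, (∃ y, ∀ k, 0 < inputOutputFunctionals (A ω) k y) →
      ∃ x : Fin n → ℝ, IsPositiveVec x ∧ IsStrictlyPositiveVec ((A ω).mulVec x) :=
    fun ω ⟨y, hy⟩ => ⟨y, ⟨fun j => (hy (Sum.inl j)).le, ⟨0, hn⟩, hy (Sum.inl _)⟩,
      fun i => hy (Sum.inr i)⟩
  have pos_of_strict : ∀ ω,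
      (∃ x : Fin n → ℝ, IsPositiveVec x ∧ IsStrictlyPositiveVec ((A ω).mulVec x)) →
      ∃ x : Fin n → ℝ, IsPositiveVec x ∧ IsPositiveVec ((A ω).mulVec x) :=
    fun ω ⟨x, hx, hAx⟩ => ⟨x, hx, fun i => (hAx i).le, ⟨0, hm⟩, hAx _⟩
  -- in general position, weak positivity of a nonzero input and its output can be made strict
  have imp_strict : ∀ ω, InGeneralPosition (inputOutputFunctionals (A ω)) →
      (∃ x : Fin n → ℝ, IsPositiveVec x ∧ IsPositiveVec ((A ω).mulVec x)) →
      ∃ y, ∀ k, 0 < inputOutputFunctionals (A ω) k y := by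
    rintro ω hω ⟨x, ⟨hx, j, hj⟩, hAx, -⟩
    refine hω.exists_forall_pos (y := x) (fun h => ?_) ?_
    · rw [h] at hj
      exact lt_irrefl _ hj
    · rintro (j | i)
      · exact hx j
      · exact hAx i
  refine ⟨?_, ?_, ?_⟩
  · rw [← hpos]
    refine measureReal_congr (Filter.eventuallyEq_set.2 ?_)
    filter_upwards [hgp] with ω hω
    exact ⟨fun h => imp_strict ω hω (pos_of_strict ω h), strict_imp ω⟩
  · rw [← hpos]
    refine measureReal_congr (Filter.eventuallyEq_set.2 ?_)
    filter_upwards [hgp] with ω hω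
    exact ⟨imp_strict ω hω, fun h => pos_of_strict ω (strict_imp ω h)⟩
  · intro Ω' _ ν _ z hz hind heven
    have : Nonempty (Fin (n + m)) := ⟨⟨0, by lia⟩⟩
    simpa using measureReal_zero_notMem_convexHull ν (by simp) hz hind heven
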